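/- Model. In the CONGEST model the vertices of a connected simple graph $G=(V,E)$ with $n$ vertices communicate in synchronous rounds over the edges of $G$; in each round every vertex may send a message of $O(\log n)$ bits to each of its neighbours, possibly different ones to different neighbours. The vertices have distinct identifiers in $\{0,\dots,n^{\kappa}-1\}$ for a constant $\kappa$. Initially a vertex knows $n$, its own identifier, the identifiers of its neighbours and its own private sequence of independent fair random bits. Local computation is unbounded. For $S\subseteq V$ let $E(S,V\setminus S)$ be the set of edges between $S$ and $V\setminus S$, and let $c^*=\max_{S\subseteq V}|E(S,V\setminus S)|$. Theorem. For every constant $\epsilon>0$ there is a constant $k=k(\epsilon)$ such that for all constants $\kappa$ and $c$ there is a randomized algorithm in the CONGEST model which on every connected $n$-vertex graph $G$, for every assignment of identifiers as above, stops after $O(n\log^{k} n)=\tilde O(n)$ rounds and computes a $(1-\epsilon)$-approximation of the maximum cut of $G$ with probability at least $1-n^{-c}$ (the constants hidden in the $O$-notation for the message size and the number of rounds may depend on $\epsilon,\kappa,c$). That is, with probability at least $1-n^{-c}$, the set $S$ of the vertices that choose the first of two sides satisfies $|E(S,V\setminus S)|\ge(1-\epsilon)c^*$, and all vertices output a common number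 $q$ with $(1-\epsilon)c^*\le q\le c^*$. -/

import Mathlib

open Finset MeasureTheory Asymptotics

/-- The number of edges of `G` between `S` and its complement. -/
def cutSize {V : Type*} [Fintype V] [DecidableEq V] (G : SimpleGraph V) [DecidableRel G.Adj]
    (S : Finset V) : ℕ :=
  #(G.interedges S Sᶜ)

/-- The size of a maximum cut of the (unweighted) graph `G`. -/
def maxCut {V : Type*} [Fintype V] [DecidableEq V] (G : SimpleGraph V) [DecidableRel G.Adj] : ℕ :=
  (univ : Finset (Finset V)).sup (cutSize G)

/-- A message of at most `b` bits (the empty message stands for silence). -/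
abbrev Message (b : ℕ) : Type := {m : List Bool // m.length ≤ b}

/-- A randomized algorithm in the synchronous CONGEST model in which, on an `n`-vertex network,
each vertex may send to each of its neighbours, in every round, its own message of at most
`β * ⌈log₂ n⌉` bits. All vertices run the same program and know `n`. Local computation is
unbounded; all vertices stop after `rounds n` rounds and then produce their outputs. -/
structure CongestAlgorithm (β : ℕ) (Out : Type) where
  /-- The local states of a vertex. -/
  State : Type
  /-- The initial state of a vertex, computed from `n`, its own identifier, the set of
  identifiers of its neighbours, and its own infinite tape of random bits. -/
  init : (n : ℕ) → (ident : ℕ) → (nbrs : Finset ℕ) → (tape : ℕ → Bool) → State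
  /-- The message that a vertex in the given state sends to its neighbour with the given
  identifier. -/
  send : (n : ℕ) → State → (dest : ℕ) → Message (β * Nat.clog 2 n)
  /-- The new state, computed from the old one and the messages received in this round; these
  are indexed by the identifiers of the senders. -/
  step : (n : ℕ) → State → (inbox : ℕ → List Bool) → State
  /-- The number of rounds on networks with `n` vertices. -/
  rounds : ℕ → ℕ
  /-- The output of a vertex, read off its final state. -/
  output : (n : ℕ) → State → Out

namespace CongestAlgorithm

variable {β : ℕ} {Out : Type} (A : CongestAlgorithm β Out)
  {V : Type*} [Fintype V] [DecidableEq V] (G : SimpleGraph V) [DecidableRel G.Adj] (ident : V → ℕ)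

/-- The messages that `v` receives in one round if the current states are `s`: at the identifier
of a neighbour `u` stands the message from `u` to `v`, elsewhere the empty message. -/
noncomputable def inbox (s : V → A.State) (v : V) : ℕ → List Bool :=
  Function.extend (fun u : G.neighborSet v => ident u)
    (fun u => (A.send (Fintype.card V) (s u) (ident v)).1) (fun _ => [])

/-- The states of all vertices after `t` rounds, when vertex `v` has the identifier `ident v` and
the random bits `ω (v, 0), ω (v, 1), …`. -/
noncomputable def run (ω : V × ℕ → Bool) : ℕ → V → A.State
  | 0 => fun v => A.init (Fintype.card V) (ident v) ((G.neighborFinset v).image ident)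
      (fun k => ω (v, k))
  | t + 1 => fun v => A.step (Fintype.card V) (run ω t v) (A.inbox G ident (run ω t) v)

/-- The output of vertex `v` when the algorithm stops. -/
noncomputable def result (ω : V × ℕ → Bool) (v : V) : Out :=
  A.output (Fintype.card V) (A.run G ident ω (A.rounds (Fintype.card V)) v)

end CongestAlgorithm

/-- The law of the private random bits: independent fair coins, infinitely many per vertex. -/
noncomputable def coinLaw (V : Type*) : Measure (V × ℕ → Bool) :=
  Measure.infinitePi fun _ => (PMF.uniformOfFintype Bool).toMeasure

/-- The outputs `out` (a side and a number at each vertex) form a `(1 - ε)`-approximation of the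
maximum cut of `G`: the chosen sides form a cut with at least `(1 - ε)` times the optimal number
of edges, and all vertices report the same value, which lies between `(1 - ε)` times the optimum
and the optimum. -/
def IsMaxCutApprox {V : Type*} [Fintype V] [DecidableEq V] (G : SimpleGraph V) [DecidableRel G.Adj]
    (ε : ℝ) (out : V → Bool × ℚ) : Prop :=
  (1 - ε) * (maxCut G : ℝ) ≤ (cutSize G {v | (out v).1 = true} : ℝ) ∧
  ∃ q : ℚ, (∀ v, (out v).2 = q) ∧ (1 - ε) * (maxCut G : ℝ) ≤ (q : ℝ) ∧ (q : ℝ) ≤ (maxCut G : ℝ)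

/-! The graph is sparsified by sampling until all of it can be sent to every vertex. Each of the `m`
edges is kept with probability `p = 2⁻ʲ`, where `j` makes `p * m` lie between `C * n` and `2 * C *
n`; if `m` is too small for this, all edges are kept. By a Chernoff bound
(`chernoff_headsIndicator`) a fixed cut has, up to an error of `δ * p * m`, the expected number of
sampled edges, except with probability `2 * exp (-C * n * δ² / 4)`. For large `C` this survives a
union bound over all `2 ^ n` cuts (`prob_failure_le`). Since `m ≤ 2 * maxCut`
(`card_orientedEdges_le_two_mul_maxCut`), an optimal cut of the sample is then nearly optimal in `G`
(`isMaxCutApprox_of_concentrated`).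

Only `O(n)` items have to reach everybody: one degree per vertex, which reveals `m` and hence `j`,
and the sampled edges. Pipelined flooding delivers `K` items in `K + n` rounds
(`flooding_complete`), so `O(n)` rounds suffice. All vertices then solve the same problem locally,
with the same choice among optimal cuts. -/

/-! ### Flooding -/

/-- Flooding one token per round: if every vertex that knows a token which it has not sent sends a
new one to all its neighbours, then after `t` rounds a vertex at distance at most `d` from `u`
knows all that `u` knew at the start, or it knows more than `t - d` tokens. -/
theorem flooding_progress {V τ : Type*} [DecidableEq τ] {G : SimpleGraph V}
    {known sent : ℕ → V → Finset τ}
    (known_mono : ∀ t v, known t v ⊆ known (t + 1) v)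
    (sent_mono : ∀ t v, sent t v ⊆ sent (t + 1) v)
    (sent_known : ∀ t u v, G.Adj u v → sent t u ⊆ known t v)
    (send_new : ∀ t u, ¬ known t u ⊆ sent t u → #(sent t u) < #(sent (t + 1) u))
    (t₀ : ℕ) {v u : V} (w : G.Walk v u) (t : ℕ) :
    known t₀ u ⊆ known (t₀ + t) v ∨ t < #(known (t₀ + t) v) + w.length := by
  induction w generalizing t with
  | nil => exact .inl (monotone_nat_of_le_succ (f := fun t => known t _)
      (fun t => known_mono t _) (Nat.le_add_right t₀ t))
  | @cons v v' u h w ih =>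
    -- The same alternative for what the next vertex `v'` of the walk has sent. In each round either
    -- `v'` sends something new, or it has sent all it knows and the bound on `known` carries over
    -- to `sent`.
    have key : ∀ t, known t₀ u ⊆ sent (t₀ + t) v' ∨ t ≤ #(sent (t₀ + t) v') + w.length := by
      intro t
      induction t with
      | zero => exact .inr (Nat.zero_le _)
      | succ t iht =>
        have hm : sent (t₀ + t) v' ⊆ sent (t₀ + (t + 1)) v' := sent_mono _ _
        have hc := card_le_card hm
        rcases iht with h1 | h1
        · exact .inl (h1.trans hm)
        · by_cases hs : known (t₀ + t) v' ⊆ sent (t₀ + t) v'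
          · have hc' := card_le_card hs
            rcases ih t with h2 | h2
            · exact .inl ((h2.trans hs).trans hm)
            · right; omega
          · have := send_new _ _ hs
            right
            rw [← add_assoc]
            omega
    have hk := sent_known (t₀ + t) v' v h.symm
    have hc := card_le_card hk
    rw [SimpleGraph.Walk.length_cons]
    rcases key t with h1 | h1
    · exact .inl (h1.trans hk)
    · right; omega

/-- A path has fewer than `card V` edges, so the second alternative of `flooding_progress` would
give more than `K` known tokens. New tokens may appear anywhere at any time, which lets one process
serve both phases of the algorithm. -/
theorem flooding_complete {V τ : Type*} [Fintype V] [DecidableEq τ]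
    {G : SimpleGraph V} (hG : G.Connected) {known sent : ℕ → V → Finset τ}
    (known_mono : ∀ t v, known t v ⊆ known (t + 1) v)
    (sent_mono : ∀ t v, sent t v ⊆ sent (t + 1) v)
    (sent_known : ∀ t u v, G.Adj u v → sent t u ⊆ known t v)
    (send_new : ∀ t u, ¬ known t u ⊆ sent t u → #(sent t u) < #(sent (t + 1) u))
    {t₀ t K : ℕ} (hK : ∀ v, #(known (t₀ + t) v) ≤ K) (ht : K + Fintype.card V ≤ t) (u v : V) :
    known t₀ u ⊆ known (t₀ + t) v := by
  classical
  obtain ⟨p, hp⟩ := (hG v u).exists_isPath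
  have hl := hp.length_lt
  have := hK v
  rcases flooding_progress known_mono sent_mono sent_known send_new t₀ p t with h | h
  · exact h
  · omega

/-! ### Cuts -/

section Cuts
variable {V : Type*} [Fintype V] [DecidableEq V] (G : SimpleGraph V) [DecidableRel G.Adj]
  (ident : V → ℕ)

/-- The edges of `G`, oriented from the smaller to the larger identifier. -/
def orientedEdges : Finset (V × V) := {e | G.Adj e.1 e.2 ∧ ident e.1 < ident e.2}

/-- The oriented edges of `G` that are cut by `S`. -/
def cutEdges (S : Finset V) : Finset (V × V) :=
  {e ∈ orientedEdges G ident | ¬ (e.1 ∈ S ↔ e.2 ∈ S)}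

/-- `interedges` orients a cut edge out of `S`, `cutEdges` by identifiers; swapping the ends where
the two disagree is a bijection. The second orientation does not depend on `S`, so one sample serves
all cuts. -/
theorem cutSize_eq_card_cutEdges (hid : Function.Injective ident) (S : Finset V) :
    cutSize G S = #(cutEdges G ident S) := by
  unfold cutSize
  refine card_bij' (fun e _ => if ident e.1 < ident e.2 then e else e.swap)
    (fun e _ => if e.1 ∈ S then e else e.swap) ?_ ?_ ?_ ?_
  · rintro ⟨a, b⟩ h
    rw [SimpleGraph.mem_interedges_iff] at h
    obtain ⟨ha, hb, hab⟩ := h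
    have hne : ident a ≠ ident b := fun h => hab.ne (hid h)
    have := hab.symm
    simp only [cutEdges, orientedEdges, mem_filter, mem_univ, true_and, mem_compl] at *
    split_ifs with h
    · simp_all
    · have : ident b < ident a := by omega
      simp_all
  · rintro ⟨a, b⟩ h
    simp only [cutEdges, orientedEdges, mem_filter, mem_univ, true_and] at h
    have := h.1.1.symm
    rw [SimpleGraph.mem_interedges_iff]
    split_ifs with h' <;> simp_all
  · rintro ⟨a, b⟩ h
    rw [SimpleGraph.mem_interedges_iff] at h
    obtain ⟨ha, hb, hab⟩ := h
    simp only [mem_compl] at *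
    split_ifs <;> simp_all
  · rintro ⟨a, b⟩ h
    simp only [cutEdges, orientedEdges, mem_filter, mem_univ, true_and] at h
    have := h.1.2.not_gt
    dsimp only
    split_ifs <;> simp_all
    omega

/-- Toggling the membership of `a` exchanges the sets that separate `a` from `b` with those that do
not. -/
theorem card_separating {a b : V} (h : a ≠ b) :
    2 * #{S : Finset V | ¬ (a ∈ S ↔ b ∈ S)} = #(univ : Finset (Finset V)) := by
  have h1 : #{S : Finset V | ¬ (a ∈ S ↔ b ∈ S)} = #{S : Finset V | (a ∈ S ↔ b ∈ S)} := by
    refine card_bij' (fun S _ => symmDiff S {a}) (fun S _ => symmDiff S {a}) ?_ ?_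
      (fun S _ => symmDiff_symmDiff_cancel_right _ _)
      (fun S _ => symmDiff_symmDiff_cancel_right _ _)
    all_goals
      intro S hS
      simp only [mem_filter, mem_univ, true_and, mem_symmDiff, mem_singleton] at *
      have := h.symm
      tauto
  have h2 := card_filter_add_card_filter_not (s := (univ : Finset (Finset V)))
    (fun S => (a ∈ S ↔ b ∈ S))
  omega

/-- A uniformly random `S` cuts half of the edges on average; this is double counting of pairs of a
set and an edge that it cuts. -/
theorem card_orientedEdges_le_two_mul_maxCut (hid : Function.Injective ident) :
    #(orientedEdges G ident) ≤ 2 * maxCut G := by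
  have hsum : ∑ S : Finset V, 2 * #(cutEdges G ident S)
      = #(univ : Finset (Finset V)) * #(orientedEdges G ident) := by
    rw [← mul_sum]
    simp_rw [cutEdges, card_filter]
    rw [sum_comm, mul_sum, mul_comm, ← smul_eq_mul, ← sum_const]
    refine sum_congr rfl fun e he => ?_
    rw [← card_filter]
    refine card_separating fun h => ?_
    simp only [orientedEdges, mem_filter, mem_univ, true_and] at he
    exact he.1.ne h
  have hle : ∑ S : Finset V, 2 * #(cutEdges G ident S) ≤ ∑ _S : Finset V, 2 * maxCut G := by
    refine sum_le_sum fun S _ => Nat.mul_le_mul_left 2 ?_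
    rw [← cutSize_eq_card_cutEdges G ident hid]
    exact le_sup (mem_univ S)
  rw [hsum, sum_const, smul_eq_mul] at hle
  exact Nat.le_of_mul_le_mul_left hle (card_pos.2 ⟨∅, mem_univ _⟩)

theorem cutSize_le_maxCut (S : Finset V) : cutSize G S ≤ maxCut G := le_sup (mem_univ S)

theorem exists_cutSize_eq_maxCut : ∃ S : Finset V, cutSize G S = maxCut G := by
  obtain ⟨S, -, hS⟩ := exists_mem_eq_sup (univ : Finset (Finset V)) ⟨∅, mem_univ _⟩ (cutSize G)
  exact ⟨S, hS.symm⟩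

end Cuts

/-! ### Concentration of random subsets -/

section Sampling
variable {V α : Type*}

instance (V : Type*) : IsProbabilityMeasure (coinLaw V) := by
  unfold coinLaw; infer_instance

theorem coinLaw_real_all_true (s : Finset (V × ℕ)) :
    (coinLaw V).real {ω | ∀ k ∈ s, ω k = true} = (1 / 2) ^ #s := by
  have h : {ω : V × ℕ → Bool | ∀ k ∈ s, ω k = true} = Set.pi s (fun _ => {true}) := by
    ext ω; simp [Set.mem_pi]
  rw [h, measureReal_def, coinLaw, Measure.infinitePi_pi _ (fun _ _ => MeasurableSet.of_discrete)]
  simp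

/-- The indicator of the event that all coins in `J` show heads. -/
noncomputable def headsIndicator (J : Finset (V × ℕ)) (ω : V × ℕ → Bool) : ℝ :=
  if ∀ k ∈ J, ω k = true then 1 else 0

theorem measurableSet_all_true (s : Finset (V × ℕ)) :
    MeasurableSet {ω : V × ℕ → Bool | ∀ k ∈ s, ω k = true} := by
  have h : {ω : V × ℕ → Bool | ∀ k ∈ s, ω k = true} = ⋂ k ∈ s, (fun ω => ω k) ⁻¹' {true} := by
    ext ω; simp
  rw [h]
  exact s.measurableSet_biInter fun k _ => measurable_pi_apply k (MeasurableSet.of_discrete)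

theorem headsIndicator_eq_indicator (J : Finset (V × ℕ)) :
    headsIndicator J = Set.indicator {ω | ∀ k ∈ J, ω k = true} (fun _ => (1 : ℝ)) := by
  classical
  ext ω
  simp [headsIndicator, Set.indicator_apply]

theorem integrable_headsIndicator (J : Finset (V × ℕ)) :
    Integrable (headsIndicator J) (coinLaw V) := by
  rw [headsIndicator_eq_indicator]
  exact (integrable_const 1).indicator (measurableSet_all_true J)

theorem integral_headsIndicator (J : Finset (V × ℕ)) :
    ∫ ω, headsIndicator J ω ∂coinLaw V = (1 / 2) ^ #J := by
  rw [headsIndicator_eq_indicator, integral_indicator_const _ (measurableSet_all_true J),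
    coinLaw_real_all_true]
  simp

variable [DecidableEq V]

theorem prod_headsIndicator (J : α → Finset (V × ℕ)) (A : Finset α) (ω : V × ℕ → Bool) :
    ∏ e ∈ A, headsIndicator (J e) ω = headsIndicator (A.biUnion J) ω := by
  classical
  simp only [headsIndicator, Finset.prod_ite_zero, prod_const_one]
  refine if_congr ?_ rfl rfl
  simp only [mem_biUnion]
  exact ⟨fun h k ⟨e, he, hk⟩ => h e he k hk, fun h e he k hk => h k ⟨e, he, hk⟩⟩

/-- Expanding the product over subsets of `F` reduces the moment generating function to
probabilities that a finite set of coins shows only heads. No independence of the indicators has to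
be stated. -/
theorem exp_mul_sum_headsIndicator (J : α → Finset (V × ℕ)) (F : Finset α) (l : ℝ)
    (ω : V × ℕ → Bool) :
    Real.exp (l * ∑ e ∈ F, headsIndicator (J e) ω) =
      ∑ A ∈ F.powerset, (Real.exp l - 1) ^ #A * headsIndicator (A.biUnion J) ω := by
  rw [mul_sum, Real.exp_sum]
  have h : ∀ e ∈ F, Real.exp (l * headsIndicator (J e) ω)
      = 1 + (Real.exp l - 1) * headsIndicator (J e) ω := by
    intro e _
    unfold headsIndicator
    split_ifs <;> simp
  rw [prod_congr rfl h, prod_one_add]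
  exact sum_congr rfl fun A _ => by rw [prod_mul_distrib, prod_const, prod_headsIndicator]

variable {J : α → Finset (V × ℕ)} {j : ℕ}

theorem integrable_exp_mul_sum_headsIndicator (J : α → Finset (V × ℕ)) (F : Finset α) (l : ℝ) :
    Integrable (fun ω => Real.exp (l * ∑ e ∈ F, headsIndicator (J e) ω)) (coinLaw V) := by
  simp_rw [exp_mul_sum_headsIndicator]
  exact integrable_finsetSum _ fun A _ => (integrable_headsIndicator _).const_mul _

theorem mgf_sum_headsIndicator {F : Finset α} (hd : (F : Set α).PairwiseDisjoint J)
    (hc : ∀ e ∈ F, #(J e) = j) (l : ℝ) :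
    ProbabilityTheory.mgf (fun ω => ∑ e ∈ F, headsIndicator (J e) ω) (coinLaw V) l =
      (1 + (Real.exp l - 1) * (1 / 2) ^ j) ^ #F := by
  unfold ProbabilityTheory.mgf
  simp_rw [exp_mul_sum_headsIndicator]
  rw [integral_finsetSum _ fun A _ => (integrable_headsIndicator _).const_mul _,
    ← prod_const, prod_one_add]
  refine sum_congr rfl fun A hA => ?_
  rw [mem_powerset] at hA
  rw [integral_const_mul, integral_headsIndicator, prod_const, mul_pow, ← pow_mul,
    card_biUnion (fun x hx y hy h => hd (hA hx) (hA hy) h),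
    sum_congr rfl (fun e he => hc e (hA he)), sum_const, smul_eq_mul, mul_comm j]

theorem mgf_sum_headsIndicator_le {F : Finset α} (hd : (F : Set α).PairwiseDisjoint J)
    (hc : ∀ e ∈ F, #(J e) = j) {l : ℝ} (hl : |l| ≤ 1) :
    ProbabilityTheory.mgf (fun ω => ∑ e ∈ F, headsIndicator (J e) ω) (coinLaw V) l ≤
      Real.exp ((1 / 2) ^ j * #F * (l + l ^ 2)) := by
  rw [mgf_sum_headsIndicator hd hc]
  have hp : (0 : ℝ) ≤ (1 / 2) ^ j := by positivity
  have hp1 : (1 / 2 : ℝ) ^ j ≤ 1 := pow_le_one₀ (by norm_num) (by norm_num)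
  have h1 : (0 : ℝ) ≤ 1 + (Real.exp l - 1) * (1 / 2) ^ j := by
    nlinarith [mul_nonneg (Real.exp_pos l).le hp]
  have h2 : Real.exp l - 1 ≤ l + l ^ 2 := by
    linarith [(abs_le.1 (Real.abs_exp_sub_one_sub_id_le hl)).2]
  calc (1 + (Real.exp l - 1) * (1 / 2) ^ j) ^ #F
      ≤ (Real.exp ((l + l ^ 2) * (1 / 2) ^ j)) ^ #F := by
        refine pow_le_pow_left₀ h1 ?_ _
        have := Real.add_one_le_exp ((l + l ^ 2) * (1 / 2) ^ j)
        nlinarith [mul_le_mul_of_nonneg_right h2 hp]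
    _ = Real.exp ((1 / 2) ^ j * #F * (l + l ^ 2)) := by
        rw [← Real.exp_nat_mul]
        ring_nf

/-- A Chernoff bound for the number of sampled elements of `F`, where each of at most `m` elements
is sampled with probability `(1 / 2) ^ j`. -/
theorem chernoff_headsIndicator {F : Finset α} (hd : (F : Set α).PairwiseDisjoint J)
    (hc : ∀ e ∈ F, #(J e) = j) {m : ℕ} (hF : #F ≤ m) {δ : ℝ} (hδ : 0 ≤ δ) (hδ1 : δ ≤ 1) :
    (coinLaw V).real {ω | δ * ((1 / 2) ^ j * m) <
        |∑ e ∈ F, headsIndicator (J e) ω - (1 / 2) ^ j * #F|} ≤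
      2 * Real.exp (-((1 / 2) ^ j * m * (δ ^ 2 / 4))) := by
  set p : ℝ := (1 / 2) ^ j with hp_def
  have hp : 0 ≤ p := by positivity
  have hFm : (#F : ℝ) ≤ m := by exact_mod_cast hF
  have habs : |δ / 2| ≤ 1 := by rw [abs_of_nonneg (by linarith)]; linarith
  -- With `l = ± δ / 2` the exponent is at most `p * #F * δ² / 4 - p * m * δ² / 2`. Measuring the
  -- error against `m` instead of `#F` gives small cuts the same failure bound.
  have key : p * #F * (δ / 2) ^ 2 ≤ p * m * (δ / 2) ^ 2 := by gcongr
  have hup := ProbabilityTheory.measure_ge_le_exp_mul_mgf (μ := coinLaw V)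
    (p * #F + δ * (p * m)) (by linarith : 0 ≤ δ / 2) (integrable_exp_mul_sum_headsIndicator J F _)
  have hlo := ProbabilityTheory.measure_le_le_exp_mul_mgf (μ := coinLaw V)
    (p * #F - δ * (p * m)) (by linarith : -(δ / 2) ≤ 0)
    (integrable_exp_mul_sum_headsIndicator J F _)
  have hup' : Real.exp (-(δ / 2) * (p * #F + δ * (p * m))) * ProbabilityTheory.mgf
      (fun ω => ∑ e ∈ F, headsIndicator (J e) ω) (coinLaw V) (δ / 2) ≤
      Real.exp (-(p * m * (δ ^ 2 / 4))) := by
    refine (mul_le_mul_of_nonneg_left (mgf_sum_headsIndicator_le hd hc habs)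
      (Real.exp_pos _).le).trans ?_
    rw [← Real.exp_add, Real.exp_le_exp]
    linarith
  have hlo' : Real.exp (-(-(δ / 2)) * (p * #F - δ * (p * m))) * ProbabilityTheory.mgf
      (fun ω => ∑ e ∈ F, headsIndicator (J e) ω) (coinLaw V) (-(δ / 2)) ≤
      Real.exp (-(p * m * (δ ^ 2 / 4))) := by
    refine (mul_le_mul_of_nonneg_left (mgf_sum_headsIndicator_le hd hc (by rwa [abs_neg]))
      (Real.exp_pos _).le).trans ?_
    rw [← Real.exp_add, Real.exp_le_exp]
    linarith
  calc _ ≤ (coinLaw V).real ({ω | p * #F + δ * (p * m) ≤ ∑ e ∈ F, headsIndicator (J e) ω} ∪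
          {ω | ∑ e ∈ F, headsIndicator (J e) ω ≤ p * #F - δ * (p * m)}) := by
        refine measureReal_mono fun ω hω => ?_
        simp only [Set.mem_ofPred_eq, Set.mem_union] at *
        rcases lt_abs.1 hω with h | h
        · left; linarith
        · right; linarith
    _ ≤ _ := by
        refine (measureReal_union_le _ _).trans ?_
        linarith

end Sampling

/-! ### The algorithm -/

/-- The items that are flooded through the network: `(false, a, d)` says that the vertex with
identifier `a` has `d` neighbours with a larger identifier, and `(true, a, b)` says that the edge
between the vertices with identifiers `a < b` has been sampled. -/
abbrev Token : Type := Bool × ℕ × ℕ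

/-- The binary encoding of a token. -/
def tokenBits (x : Token) : List Bool := x.1 :: Nat.bits (Nat.pair x.2.1 x.2.2)

theorem tokenBits_injective : Function.Injective tokenBits := by
  have hbits : Function.Injective Nat.bits := by
    intro a
    induction a using Nat.binaryRec' with
    | zero =>
      intro b h
      rcases eq_or_ne b 0 with rfl | hb
      · rfl
      · have h2 := Nat.size_eq_bits_len b
        rw [← h, Nat.zero_bits, List.length_nil, eq_comm, Nat.size_eq_zero] at h2
        exact h2.symm
    | bit x a hx ih =>
      intro b h
      induction b using Nat.binaryRec' with
      | zero => simp [Nat.bits_append_bit _ _ hx] at h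
      | bit y b hy _ =>
        rw [Nat.bits_append_bit _ _ hx, Nat.bits_append_bit _ _ hy, List.cons.injEq] at h
        rw [h.1, ih h.2]
  rintro ⟨x, a, b⟩ ⟨y, a', b'⟩ h
  simp only [tokenBits, List.cons.injEq] at h
  have := Nat.pair_eq_pair.1 (hbits h.2)
  simp [h.1, this]

/-- Pairing squares the bound `n ^ (κ + 1)`, which accounts for `2 * κ + 2` logarithms; the flag bit
costs at most one more. The exponent `κ + 1` leaves room for degrees as well as identifiers. -/
theorem length_tokenBits_le {x : Token} {n κ : ℕ} (hn : 2 ≤ n) (h1 : x.2.1 < n ^ (κ + 1))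
    (h2 : x.2.2 < n ^ (κ + 1)) : (tokenBits x).length ≤ (2 * κ + 3) * Nat.clog 2 n := by
  have hc : 1 ≤ Nat.clog 2 n := Nat.clog_pos (by norm_num) hn
  have hp : Nat.pair x.2.1 x.2.2 < 2 ^ (Nat.clog 2 n * (2 * κ + 2)) := by
    calc Nat.pair x.2.1 x.2.2 < (max x.2.1 x.2.2 + 1) ^ 2 := Nat.pair_lt_max_add_one_sq _ _
      _ ≤ (n ^ (κ + 1)) ^ 2 := Nat.pow_le_pow_left (by omega) 2
      _ = n ^ (2 * κ + 2) := by ring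
      _ ≤ (2 ^ Nat.clog 2 n) ^ (2 * κ + 2) :=
        Nat.pow_le_pow_left (Nat.le_pow_clog (by norm_num) n) _
      _ = _ := by rw [pow_mul]
  have := Nat.size_le.2 hp
  simp only [tokenBits, List.length_cons, Nat.size_eq_bits_len]
  nlinarith

/-- The state of a vertex. -/
structure NodeState where
  /-- The identifier of the vertex. -/
  ident : ℕ
  /-- The identifiers of the neighbours. -/
  nbrs : Finset ℕ
  /-- The random bits. -/
  tape : ℕ → Bool
  /-- The tokens that the vertex knows. -/
  known : Finset Token
  /-- The tokens that the vertex has sent. -/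
  sent : Finset Token

namespace NodeState

/-- The token to be sent next. -/
noncomputable def next (s : NodeState) : Option Token := (s.known \ s.sent).toList.head?

/-- The tokens contained in the messages of the neighbours. -/
noncomputable def received (s : NodeState) (inbox : ℕ → List Bool) : Finset Token :=
  s.nbrs.biUnion fun a => (Function.partialInv tokenBits (inbox a)).toFinset

theorem mem_of_next {s : NodeState} {x : Token} (h : s.next = some x) : x ∈ s.known \ s.sent :=
  mem_toList.1 (List.mem_of_mem_head? h)

theorem subset_of_next_eq_none {s : NodeState} (h : s.next = none) : s.known ⊆ s.sent := by
  rw [next, List.head?_eq_none_iff, toList_eq_nil, sdiff_eq_empty_iff_subset] at h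
  exact h

end NodeState

/-- The number of edges, computed from the tokens of all vertices. -/
def edgeCount (known : Finset Token) : ℕ := ∑ x ∈ known with x.1 = false, x.2.2

/-- Edges are sampled with probability `2⁻ʲ`, where `j = samplingExponent C n m`. -/
def samplingExponent (C n m : ℕ) : ℕ := Nat.log 2 (m / (C * n))

/-- The sampled edges, as pairs of identifiers. -/
def knownEdges (known : Finset Token) : Finset (ℕ × ℕ) := {x ∈ known | x.1 = true}.image (·.2)

/-- The tokens of the sampled edges between a vertex and its neighbours with larger identifiers.
There are none as long as the vertex has not heard of all `n` vertices. -/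
def ownSample (C n : ℕ) (s : NodeState) (known : Finset Token) : Finset Token :=
  if #{x ∈ known | x.1 = false} = n then
    {b ∈ s.nbrs | s.ident < b ∧
      ∀ i < samplingExponent C n (edgeCount known), s.tape (Nat.pair b i) = true}.image
        fun b => (true, s.ident, b)
  else ∅

/-- The number of pairs in `E` that are separated by `S`. -/
def separatedCount (E : Finset (ℕ × ℕ)) (S : Finset ℕ) : ℕ := #{e ∈ E | ¬ (e.1 ∈ S ↔ e.2 ∈ S)}

theorem exists_bestCut (N : ℕ) (E : Finset (ℕ × ℕ)) :
    ∃ S ∈ (range N).powerset, ∀ T ∈ (range N).powerset, separatedCount E T ≤ separatedCount E S :=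
  exists_max_image _ _ ⟨∅, empty_mem_powerset _⟩

/-- A set of numbers below `N` that separates as many pairs in `E` as possible. -/
noncomputable def bestCut (N : ℕ) (E : Finset (ℕ × ℕ)) : Finset ℕ := (exists_bestCut N E).choose

/-- The estimate of the maximum cut made by a vertex at the end. -/
noncomputable def cutEstimate (C : ℕ) (δ : ℚ) (n N : ℕ) (known : Finset Token) : ℚ :=
  2 ^ samplingExponent C n (edgeCount known) *
    separatedCount (knownEdges known) (bestCut N (knownEdges known)) - δ * edgeCount known

/-- Every vertex floods the number of its neighbours with larger identifiers. When it knows these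
numbers for all vertices, it samples edges to its neighbours with larger identifiers and floods
these. At the end it computes a maximum cut of the graph of all sampled edges. -/
noncomputable def maxCutAlgorithm (C κ : ℕ) (δ : ℚ) :
    CongestAlgorithm (2 * κ + 3) (Bool × ℚ) where
  State := NodeState
  init _ ident nbrs tape :=
    { ident, nbrs, tape, known := {(false, ident, #{b ∈ nbrs | ident < b})}, sent := ∅ }
  send n s _ :=
    if h : ((s.next.map tokenBits).getD []).length ≤ (2 * κ + 3) * Nat.clog 2 n then ⟨_, h⟩
    else ⟨[], Nat.zero_le _⟩
  step n s inbox :=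
    { s with
      known := (s.known ∪ s.received inbox) ∪ ownSample C n s (s.known ∪ s.received inbox)
      sent := s.sent ∪ s.next.toFinset }
  -- At most `(4 * C + 1) * n` tokens are expected: `n` for vertices and `4 * C * n` for sampled
  -- edges. There are two floodings and one round for sampling between them.
  rounds n := 2 * ((4 * C + 1) * n + n) + 1
  output n s :=
    (decide (s.ident ∈ bestCut (n ^ κ) (knownEdges s.known)), cutEstimate C δ n (n ^ κ) s.known)

set_option linter.unusedSectionVars false

/-! ### Analysis of a run of the algorithm -/

section Run
variable {V : Type*} [Fintype V] [DecidableEq V] (G : SimpleGraph V) [DecidableRel G.Adj]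
  (ident : V → ℕ) (ω : V × ℕ → Bool) (C κ : ℕ) (δ : ℚ)

/-- The coins that decide whether the edge `e` is sampled with probability `2⁻ʲ`. -/
def edgeCoins (j : ℕ) (e : V × V) : Finset (V × ℕ) :=
  (range j).image fun i => (e.1, Nat.pair (ident e.2) i)

theorem card_edgeCoins (j : ℕ) (e : V × V) : #(edgeCoins ident j e) = j := by
  rw [edgeCoins, card_image_of_injective, card_range]
  intro i i' h
  simpa using h

variable {ident} in
-- A coin determines its edge: its owner is the smaller end, and its position on the tape encodes
-- the identifier of the larger end.
theorem pairwiseDisjoint_edgeCoins (hid : Function.Injective ident) (j : ℕ) (F : Set (V × V)) :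
    F.PairwiseDisjoint (edgeCoins ident j) := by
  rintro ⟨a, b⟩ _ ⟨a', b'⟩ _ hne
  refine disjoint_left.2 fun x hx hx' => hne ?_
  simp only [edgeCoins, mem_image, mem_range] at hx hx'
  obtain ⟨i, -, rfl⟩ := hx
  obtain ⟨i', -, h⟩ := hx'
  simp only [Prod.mk.injEq, Nat.pair_eq_pair] at h
  rw [h.1, hid h.2.1]

/-- The sampled edges. -/
def sampledEdges : Finset (V × V) :=
  {e ∈ orientedEdges G ident | ∀ k ∈ edgeCoins ident
    (samplingExponent C (Fintype.card V) #(orientedEdges G ident)) e, ω k = true}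

/-- The token that a vertex knows initially. -/
def vertexToken (v : V) : Token :=
  (false, ident v, #{b ∈ (G.neighborFinset v).image ident | ident v < b})

/-- The token of an edge. -/
def edgeToken (e : V × V) : Token := (true, ident e.1, ident e.2)

/-- All tokens that are ever flooded. -/
def allTokens : Finset Token :=
  univ.image (vertexToken G ident) ∪ (sampledEdges G ident ω C).image (edgeToken ident)

theorem card_allTokens_le :
    #(allTokens G ident ω C) ≤ Fintype.card V + #(sampledEdges G ident ω C) :=
  (card_union_le _ _).trans (Nat.add_le_add card_image_le card_image_le)

theorem filter_allTokens_false :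
    {x ∈ allTokens G ident ω C | x.1 = false} = univ.image (vertexToken G ident) := by
  ext x
  simp only [allTokens, mem_filter, mem_union, mem_image, vertexToken, edgeToken]
  constructor
  · rintro ⟨h | ⟨e, -, rfl⟩, hx⟩
    · exact h
    · simp at hx
  · rintro ⟨v, hv, rfl⟩
    exact ⟨.inl ⟨v, hv, rfl⟩, rfl⟩

theorem knownEdges_allTokens :
    knownEdges (allTokens G ident ω C) =
      (sampledEdges G ident ω C).image fun e => (ident e.1, ident e.2) := by
  ext x
  simp only [knownEdges, allTokens, mem_filter, mem_union, mem_image, vertexToken, edgeToken]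
  constructor
  · rintro ⟨y, ⟨⟨v, -, rfl⟩ | ⟨e, he, rfl⟩, hx⟩, rfl⟩
    · simp at hx
    · exact ⟨e, he, rfl⟩
  · rintro ⟨e, he, rfl⟩
    exact ⟨_, ⟨.inr ⟨e, he, rfl⟩, rfl⟩, rfl⟩

variable {ident}

theorem vertexToken_injective (hid : Function.Injective ident) :
    Function.Injective (vertexToken G ident) := by
  intro u v h
  simp only [vertexToken, Prod.mk.injEq] at h
  exact hid h.2.1

/-- Every edge is counted once, at its end with the smaller identifier. -/
theorem edgeCount_of_filter_eq (hid : Function.Injective ident) {k : Finset Token}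
    (hk : {x ∈ k | x.1 = false} = univ.image (vertexToken G ident)) :
    edgeCount k = #(orientedEdges G ident) := by
  rw [edgeCount, hk, sum_image (vertexToken_injective G hid).injOn, orientedEdges, card_filter,
    Fintype.sum_prod_type]
  refine sum_congr rfl fun v _ => ?_
  rw [← card_filter, vertexToken, filter_image, card_image_of_injective _ hid]
  refine congrArg card ?_
  ext u
  simp

theorem edgeCount_allTokens (hid : Function.Injective ident) :
    edgeCount (allTokens G ident ω C) = #(orientedEdges G ident) :=
  edgeCount_of_filter_eq G hid (filter_allTokens_false G ident ω C)

theorem length_tokenBits_le_of_mem_allTokens (hlt : ∀ v, ident v < Fintype.card V ^ κ)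
    (hn : 2 ≤ Fintype.card V) {x : Token} (hx : x ∈ allTokens G ident ω C) :
    (tokenBits x).length ≤ (2 * κ + 3) * Nat.clog 2 (Fintype.card V) := by
  have hlt' : ∀ v, ident v < Fintype.card V ^ (κ + 1) := fun v =>
    (hlt v).trans_le (Nat.pow_le_pow_right (by omega) (Nat.le_succ κ))
  simp only [allTokens, mem_union, mem_image] at hx
  rcases hx with ⟨v, -, rfl⟩ | ⟨e, -, rfl⟩
  · refine length_tokenBits_le hn (hlt' v) ?_
    calc #{b ∈ (G.neighborFinset v).image ident | ident v < b}
        ≤ G.degree v := (card_filter_le _ _).trans card_image_le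
      _ < Fintype.card V := G.degree_lt_card_verts v
      _ ≤ Fintype.card V ^ (κ + 1) := Nat.le_self_pow (Nat.succ_ne_zero κ) _
  · exact length_tokenBits_le hn (hlt' _) (hlt' _)

variable (ident)

/-- The state of the vertex `v` after `t` rounds. -/
noncomputable abbrev stateAt (t : ℕ) (v : V) : NodeState :=
  (maxCutAlgorithm C κ δ).run G ident ω t v

theorem stateAt_const (t : ℕ) (v : V) :
    (stateAt G ident ω C κ δ t v).ident = ident v ∧
    (stateAt G ident ω C κ δ t v).nbrs = (G.neighborFinset v).image ident ∧
    (stateAt G ident ω C κ δ t v).tape = fun k => ω (v, k) := by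
  induction t with
  | zero => exact ⟨rfl, rfl, rfl⟩
  | succ t ih => exact ih

/-- The tokens that `v` knows after it has read its messages in round `t + 1`. -/
noncomputable def knownAfterReceiving (t : ℕ) (v : V) : Finset Token :=
  (stateAt G ident ω C κ δ t v).known ∪ (stateAt G ident ω C κ δ t v).received
    ((maxCutAlgorithm C κ δ).inbox G ident (stateAt G ident ω C κ δ t) v)

theorem known_succ (t : ℕ) (v : V) :
    (stateAt G ident ω C κ δ (t + 1) v).known = knownAfterReceiving G ident ω C κ δ t v ∪
      ownSample C (Fintype.card V) (stateAt G ident ω C κ δ t v)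
        (knownAfterReceiving G ident ω C κ δ t v) := rfl

theorem sent_succ (t : ℕ) (v : V) :
    (stateAt G ident ω C κ δ (t + 1) v).sent =
      (stateAt G ident ω C κ δ t v).sent ∪ (stateAt G ident ω C κ δ t v).next.toFinset := rfl

theorem known_subset_knownAfterReceiving (t : ℕ) (v : V) :
    (stateAt G ident ω C κ δ t v).known ⊆ knownAfterReceiving G ident ω C κ δ t v :=
  subset_union_left

theorem knownAfterReceiving_subset (t : ℕ) (v : V) :
    knownAfterReceiving G ident ω C κ δ t v ⊆ (stateAt G ident ω C κ δ (t + 1) v).known :=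
  subset_union_left

theorem known_subset_succ (t : ℕ) (v : V) :
    (stateAt G ident ω C κ δ t v).known ⊆ (stateAt G ident ω C κ δ (t + 1) v).known :=
  (known_subset_knownAfterReceiving ..).trans (knownAfterReceiving_subset ..)

theorem sent_subset_succ (t : ℕ) (v : V) :
    (stateAt G ident ω C κ δ t v).sent ⊆ (stateAt G ident ω C κ δ (t + 1) v).sent :=
  subset_union_left

theorem card_sent_lt (t : ℕ) (v : V)
    (h : ¬ (stateAt G ident ω C κ δ t v).known ⊆ (stateAt G ident ω C κ δ t v).sent) :
    #(stateAt G ident ω C κ δ t v).sent < #(stateAt G ident ω C κ δ (t + 1) v).sent := by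
  rcases hx : (stateAt G ident ω C κ δ t v).next with _ | x
  · exact absurd (NodeState.subset_of_next_eq_none hx) h
  · refine card_lt_card (Finset.ssubset_iff_subset_ne.2 ⟨sent_subset_succ .., fun heq => ?_⟩)
    have hm := NodeState.mem_of_next hx
    rw [mem_sdiff, heq, sent_succ, hx] at hm
    simp at hm

variable {ident}

theorem inbox_eq (hid : Function.Injective ident) (t : ℕ) {u v : V} (h : G.Adj u v) :
    (maxCutAlgorithm C κ δ).inbox G ident (stateAt G ident ω C κ δ t) v (ident u) =
      ((maxCutAlgorithm C κ δ).send (Fintype.card V) (stateAt G ident ω C κ δ t u)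
        (ident v)).1 := by
  unfold CongestAlgorithm.inbox
  have hinj : Function.Injective fun u : G.neighborSet v => ident u :=
    hid.comp Subtype.val_injective
  exact hinj.extend_apply _ _ ⟨u, h.symm⟩

theorem send_eq (n t : ℕ) (u : V) (d : ℕ)
    (hlen : ∀ x ∈ (stateAt G ident ω C κ δ t u).known,
      (tokenBits x).length ≤ (2 * κ + 3) * Nat.clog 2 n) :
    ((maxCutAlgorithm C κ δ).send n (stateAt G ident ω C κ δ t u) d).1 =
      ((stateAt G ident ω C κ δ t u).next.map tokenBits).getD [] := by
  have hle : (((stateAt G ident ω C κ δ t u).next.map tokenBits).getD []).length ≤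
      (2 * κ + 3) * Nat.clog 2 n := by
    rcases hx : (stateAt G ident ω C κ δ t u).next with _ | x
    · exact Nat.zero_le _
    · exact hlen x (mem_sdiff.1 (NodeState.mem_of_next hx)).1
  simp only [maxCutAlgorithm]
  exact congrArg Subtype.val (dif_pos hle)

/-- Silence is not mistaken for a token, because every encoding begins with the flag bit. -/
theorem partialInv_tokenBits_nil : Function.partialInv tokenBits [] = none := by
  classical
  rw [Function.partialInv, dif_neg]
  rintro ⟨x, hx⟩
  exact List.cons_ne_nil _ _ hx

/-- A message carries exactly the token that its sender wanted to send. -/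
theorem partialInv_inbox (hid : Function.Injective ident)
    (hlt : ∀ v, ident v < Fintype.card V ^ κ) (t : ℕ) {u v : V} (h : G.Adj u v)
    (hu : (stateAt G ident ω C κ δ t u).known ⊆ allTokens G ident ω C) :
    Function.partialInv tokenBits
        ((maxCutAlgorithm C κ δ).inbox G ident (stateAt G ident ω C κ δ t) v (ident u)) =
      (stateAt G ident ω C κ δ t u).next := by
  have hn : 2 ≤ Fintype.card V := Fintype.one_lt_card_iff.2 ⟨u, v, h.ne⟩
  rw [inbox_eq G ω C κ δ hid t h, send_eq G ω C κ δ _ t u _ fun x hx =>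
    length_tokenBits_le_of_mem_allTokens G ω C κ hlt hn (hu hx)]
  rcases (stateAt G ident ω C κ δ t u).next with _ | x
  · exact partialInv_tokenBits_nil
  · exact Function.partialInv_left tokenBits_injective x

theorem mem_received_iff (hid : Function.Injective ident)
    (hlt : ∀ v, ident v < Fintype.card V ^ κ) (t : ℕ) (v : V)
    (hk : ∀ u, (stateAt G ident ω C κ δ t u).known ⊆ allTokens G ident ω C) {x : Token} :
    x ∈ (stateAt G ident ω C κ δ t v).received
        ((maxCutAlgorithm C κ δ).inbox G ident (stateAt G ident ω C κ δ t) v) ↔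
      ∃ u, G.Adj u v ∧ (stateAt G ident ω C κ δ t u).next = some x := by
  rw [NodeState.received, (stateAt_const G ident ω C κ δ t v).2.1]
  simp only [mem_biUnion, mem_image, SimpleGraph.mem_neighborFinset, Option.mem_toFinset,
    Option.mem_def]
  constructor
  · rintro ⟨_, ⟨u, hu, rfl⟩, hx⟩
    exact ⟨u, hu.symm, partialInv_inbox G ω C κ δ hid hlt t hu.symm (hk u) ▸ hx⟩
  · rintro ⟨u, hu, hx⟩
    exact ⟨_, ⟨u, hu.symm, rfl⟩, (partialInv_inbox G ω C κ δ hid hlt t hu (hk u)).trans hx⟩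

/-- A vertex that has heard of all vertices samples its edges correctly. -/
theorem mem_ownSample_iff (hid : Function.Injective ident) (t : ℕ) (v : V) {k : Finset Token}
    (hk : {x ∈ k | x.1 = false} = univ.image (vertexToken G ident)) {x : Token} :
    x ∈ ownSample C (Fintype.card V) (stateAt G ident ω C κ δ t v) k ↔
      ∃ e ∈ sampledEdges G ident ω C, e.1 = v ∧ edgeToken ident e = x := by
  obtain ⟨h1, h2, h3⟩ := stateAt_const G ident ω C κ δ t v
  have hcard : #{x ∈ k | x.1 = false} = Fintype.card V := by
    rw [hk, card_image_of_injective _ (vertexToken_injective G hid), card_univ]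
  rw [ownSample, if_pos hcard, h1, h2, h3, edgeCount_of_filter_eq G hid hk]
  constructor
  · intro h
    obtain ⟨b, hb, rfl⟩ := mem_image.1 h
    obtain ⟨hb, hlt, hω⟩ := mem_filter.1 hb
    obtain ⟨u, hu, rfl⟩ := mem_image.1 hb
    refine ⟨(v, u), mem_filter.2 ⟨mem_filter.2
      ⟨mem_univ _, (G.mem_neighborFinset v u).1 hu, hlt⟩, fun k hk => ?_⟩, rfl, rfl⟩
    obtain ⟨i, hi, rfl⟩ := mem_image.1 hk
    exact hω i (mem_range.1 hi)
  · rintro ⟨⟨a, u⟩, he, rfl, rfl⟩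
    obtain ⟨he, hω⟩ := mem_filter.1 he
    obtain ⟨-, hu, hlt⟩ := mem_filter.1 he
    exact mem_image.2 ⟨ident u, mem_filter.2 ⟨mem_image_of_mem _
      ((G.mem_neighborFinset a u).2 hu), hlt, fun i hi =>
        hω _ (mem_image.2 ⟨i, mem_range.2 hi, rfl⟩)⟩, rfl⟩

/-- There are at most `card V` genuine vertex tokens, so counting them is a sound local test for
having heard of all vertices. -/
theorem filter_false_eq_of_subset {k : Finset Token} (hk : k ⊆ allTokens G ident ω C)
    (h : univ.image (vertexToken G ident) ⊆ k ∨
      #{x ∈ k | x.1 = false} = Fintype.card V) :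
    {x ∈ k | x.1 = false} = univ.image (vertexToken G ident) := by
  have hsub : {x ∈ k | x.1 = false} ⊆ univ.image (vertexToken G ident) := by
    rw [← filter_allTokens_false G ident ω C]
    exact filter_subset_filter _ hk
  rcases h with h | h
  · refine hsub.antisymm ?_
    rw [← filter_allTokens_false G ident ω C]
    intro x hx
    refine mem_filter.2 ⟨h ?_, (mem_filter.1 hx).2⟩
    rwa [← filter_allTokens_false G ident ω C]
  · exact eq_of_subset_of_card_le hsub (by rw [h]; exact card_image_le)

theorem knownAfterReceiving_subset_allTokens (hid : Function.Injective ident)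
    (hlt : ∀ v, ident v < Fintype.card V ^ κ) (t : ℕ) (v : V)
    (hk : ∀ u, (stateAt G ident ω C κ δ t u).known ⊆ allTokens G ident ω C) :
    knownAfterReceiving G ident ω C κ δ t v ⊆ allTokens G ident ω C := by
  refine union_subset (hk v) fun x hx => ?_
  obtain ⟨u, -, hu⟩ := (mem_received_iff G ω C κ δ hid hlt t v hk).1 hx
  exact hk u (mem_sdiff.1 (NodeState.mem_of_next hu)).1

/-- The safety invariant. A vertex samples only after it has all degrees, hence with the correct
exponent, and its coins are fixed, so repeating `ownSample` in later rounds yields the same edges.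
-/
theorem known_subset_allTokens (hid : Function.Injective ident)
    (hlt : ∀ v, ident v < Fintype.card V ^ κ) (t : ℕ) (v : V) :
    (stateAt G ident ω C κ δ t v).known ⊆ allTokens G ident ω C := by
  induction t generalizing v with
  | zero =>
    refine singleton_subset_iff.2 (mem_union_left _ (mem_image.2 ⟨v, mem_univ v, rfl⟩))
  | succ t ih =>
    have hr := knownAfterReceiving_subset_allTokens G ω C κ δ hid hlt t v ih
    rw [known_succ]
    refine union_subset hr fun x hx => ?_
    by_cases hc : #{x ∈ knownAfterReceiving G ident ω C κ δ t v | x.1 = false} = Fintype.card V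
    · obtain ⟨e, he, -, rfl⟩ := (mem_ownSample_iff G ω C κ δ hid t v
        (filter_false_eq_of_subset G ω C hr (.inr hc))).1 hx
      exact mem_union_right _ (mem_image_of_mem _ he)
    · rw [ownSample, if_neg hc] at hx
      exact absurd hx (notMem_empty x)

/-- A token enters `sent` in the very round in which the neighbours read it. -/
theorem sent_subset_known (hid : Function.Injective ident)
    (hlt : ∀ v, ident v < Fintype.card V ^ κ) (t : ℕ) {u v : V} (h : G.Adj u v) :
    (stateAt G ident ω C κ δ t u).sent ⊆ (stateAt G ident ω C κ δ t v).known := by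
  induction t with
  | zero => exact empty_subset _
  | succ t ih =>
    rw [sent_succ]
    refine union_subset (ih.trans (known_subset_succ ..)) fun x hx => ?_
    exact knownAfterReceiving_subset _ _ _ _ _ _ _ _ (mem_union_right _
      ((mem_received_iff G ω C κ δ hid hlt t v (known_subset_allTokens G ω C κ δ hid hlt t)).2
        ⟨u, h, Option.mem_toFinset.1 hx⟩))

theorem known_flooded (hG : G.Connected) (hid : Function.Injective ident)
    (hlt : ∀ v, ident v < Fintype.card V ^ κ) {K t₀ t : ℕ}
    (hK : #(allTokens G ident ω C) ≤ K) (ht : K + Fintype.card V ≤ t) (u v : V) :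
    (stateAt G ident ω C κ δ t₀ u).known ⊆ (stateAt G ident ω C κ δ (t₀ + t) v).known :=
  flooding_complete hG (known := fun t v => (stateAt G ident ω C κ δ t v).known)
    (sent := fun t v => (stateAt G ident ω C κ δ t v).sent)
    (known_subset_succ G ident ω C κ δ) (sent_subset_succ G ident ω C κ δ)
    (fun t _ _ h => sent_subset_known G ω C κ δ hid hlt t h)
    (card_sent_lt G ident ω C κ δ)
    (fun v => (card_le_card (known_subset_allTokens G ω C κ δ hid hlt _ v)).trans hK) ht u v

/-- One flooding spreads the vertex tokens, the next round makes sure that all edges are sampled,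
and a second flooding spreads these. Vertices may sample early, so `K` has to bound all tokens
already in the first flooding. -/
theorem known_eq_allTokens (hG : G.Connected) (hid : Function.Injective ident)
    (hlt : ∀ v, ident v < Fintype.card V ^ κ) {K : ℕ}
    (hK : #(allTokens G ident ω C) ≤ K) (v : V) :
    (stateAt G ident ω C κ δ (2 * (K + Fintype.card V) + 1) v).known = allTokens G ident ω C := by
  refine (known_subset_allTokens G ω C κ δ hid hlt _ v).antisymm ?_
  set t := K + Fintype.card V with ht
  have hvert : ∀ u w, vertexToken G ident w ∈ (stateAt G ident ω C κ δ t u).known := by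
    intro u w
    have := known_flooded G ω C κ δ hG hid hlt (t₀ := 0) (t := t) hK le_rfl w u
    rw [zero_add] at this
    exact this (mem_singleton_self _)
  have hsamp : ∀ e ∈ sampledEdges G ident ω C,
      edgeToken ident e ∈ (stateAt G ident ω C κ δ (t + 1) e.1).known := by
    intro e he
    rw [known_succ]
    refine mem_union_right _ ((mem_ownSample_iff G ω C κ δ hid t e.1
      (filter_false_eq_of_subset G ω C (knownAfterReceiving_subset_allTokens G ω C κ δ hid hlt t _
        (known_subset_allTokens G ω C κ δ hid hlt t)) (.inl ?_))).2 ⟨e, he, rfl, rfl⟩)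
    intro x hx
    obtain ⟨w, -, rfl⟩ := mem_image.1 hx
    exact known_subset_knownAfterReceiving _ _ _ _ _ _ _ _ (hvert _ w)
  have h2 : 2 * t + 1 = (t + 1) + t := by ring
  rw [h2]
  refine union_subset (fun x hx => ?_) (fun x hx => ?_)
  · obtain ⟨w, -, rfl⟩ := mem_image.1 hx
    exact known_flooded G ω C κ δ hG hid hlt hK le_rfl v v
      (known_subset_succ _ _ _ _ _ _ _ _ (hvert v w))
  · obtain ⟨e, he, rfl⟩ := mem_image.1 hx
    exact known_flooded G ω C κ δ hG hid hlt hK le_rfl e.1 v (hsamp e he)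

theorem result_eq (hG : G.Connected) (hid : Function.Injective ident)
    (hlt : ∀ v, ident v < Fintype.card V ^ κ)
    (hK : #(sampledEdges G ident ω C) ≤ 4 * C * Fintype.card V) (v : V) :
    (maxCutAlgorithm C κ δ).result G ident ω v =
      (decide (ident v ∈ bestCut (Fintype.card V ^ κ) (knownEdges (allTokens G ident ω C))),
        cutEstimate C δ (Fintype.card V) (Fintype.card V ^ κ) (allTokens G ident ω C)) := by
  have hcard : #(allTokens G ident ω C) ≤ (4 * C + 1) * Fintype.card V := by
    have := card_allTokens_le G ident ω C
    linarith
  have h1 := known_eq_allTokens G ω C κ δ hG hid hlt hcard v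
  have h2 := (stateAt_const G ident ω C κ δ
    (2 * ((4 * C + 1) * Fintype.card V + Fintype.card V) + 1) v).1
  rw [← h1, ← h2]
  rfl

end Run

/-! ### Correctness -/

section Correctness
variable {V : Type*} [Fintype V] [DecidableEq V] (G : SimpleGraph V) [DecidableRel G.Adj]
  {ident : V → ℕ} (ω : V × ℕ → Bool) (C κ : ℕ) (δ : ℚ)

theorem separatedCount_image (hid : Function.Injective ident) (E : Finset (V × V)) (S : Finset ℕ) :
    separatedCount (E.image fun e => (ident e.1, ident e.2)) S =
      #{e ∈ E | ¬ (e.1 ∈ ({v | ident v ∈ S} : Finset V) ↔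
        e.2 ∈ ({v | ident v ∈ S} : Finset V))} := by
  rw [separatedCount, filter_image, card_image_of_injective]
  · simp
  · rintro ⟨a, b⟩ ⟨a', b'⟩ h
    simp only [Prod.mk.injEq] at h
    rw [hid h.1, hid h.2]

/-- If the numbers of sampled edges in all cuts are close to their expectations, then the result is
a good approximation. -/
theorem isMaxCutApprox_of_concentrated {ε : ℝ} (hδε : 4 * (δ : ℝ) ≤ ε) (hδ : 0 ≤ δ)
    (hid : Function.Injective ident) (hlt : ∀ v, ident v < Fintype.card V ^ κ) {j : ℕ}
    (hj : j = samplingExponent C (Fintype.card V) #(orientedEdges G ident))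
    (h : ∀ S : Finset V,
      |(#{e ∈ sampledEdges G ident ω C | ¬ (e.1 ∈ S ↔ e.2 ∈ S)} : ℝ)
        - (1 / 2) ^ j * #(cutEdges G ident S)| ≤ δ * ((1 / 2) ^ j * #(orientedEdges G ident))) :
    IsMaxCutApprox G ε fun v =>
      (decide (ident v ∈ bestCut (Fintype.card V ^ κ) (knownEdges (allTokens G ident ω C))),
        cutEstimate C δ (Fintype.card V) (Fintype.card V ^ κ) (allTokens G ident ω C)) := by
  set N := Fintype.card V ^ κ
  set E := knownEdges (allTokens G ident ω C) with hE
  set m := #(orientedEdges G ident) with hm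
  -- Rescaled by `2 ^ j`, the sampled count estimates every cut of `G` up to `δ * m`.
  have hcount : ∀ T : Finset ℕ, |2 ^ j * (separatedCount E T : ℝ)
      - cutSize G ({v | ident v ∈ T} : Finset V)| ≤ δ * m := by
    intro T
    have h2 : (0 : ℝ) < 2 ^ j := by positivity
    have hinv : (2 : ℝ) ^ j * (1 / 2) ^ j = 1 := by rw [← mul_pow]; norm_num
    have := mul_le_mul_of_nonneg_left (h {v | ident v ∈ T}) h2.le
    rw [hE, knownEdges_allTokens, separatedCount_image hid, cutSize_eq_card_cutEdges G ident hid]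
    rw [← abs_of_pos h2, ← abs_mul, mul_sub, ← mul_assoc, abs_of_pos h2, hinv, one_mul] at this
    refine this.trans_eq ?_
    linear_combination (δ * m : ℝ) * hinv
  obtain ⟨-, hbest⟩ := (exists_bestCut N E).choose_spec
  change ∀ T ∈ (range N).powerset, separatedCount E T ≤ separatedCount E (bestCut N E) at hbest
  obtain ⟨S, hS⟩ := exists_cutSize_eq_maxCut G
  have hopt : (maxCut G : ℝ) - δ * m ≤ 2 ^ j * (separatedCount E (S.image ident) : ℝ) := by
    have h1 := (abs_le.1 (hcount (S.image ident))).1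
    have h2 : ({v | ident v ∈ S.image ident} : Finset V) = S := by
      ext v
      simp [hid.eq_iff]
    rw [h2, hS] at h1
    linarith
  have hmem : S.image ident ∈ (range N).powerset := by
    refine mem_powerset.2 fun x hx => ?_
    obtain ⟨v, -, rfl⟩ := mem_image.1 hx
    exact mem_range.2 (hlt v)
  have hle : (2 : ℝ) ^ j * (separatedCount E (S.image ident) : ℝ) ≤
      2 ^ j * (separatedCount E (bestCut N E) : ℝ) := by
    have := hbest _ hmem
    gcongr
  have hcut := (abs_le.1 (hcount (bestCut N E))).2
  have hmax : (cutSize G ({v | ident v ∈ bestCut N E} : Finset V) : ℝ) ≤ maxCut G := by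
    exact_mod_cast cutSize_le_maxCut G _
  have hhalf : (m : ℝ) ≤ 2 * maxCut G := by
    exact_mod_cast card_orientedEdges_le_two_mul_maxCut G ident hid
  have hδ' : (0 : ℝ) ≤ δ := by exact_mod_cast hδ
  -- Two errors of `δ * m` occur: one in the optimum and one in the chosen cut, or in the amount
  -- subtracted to keep the estimate below `maxCut G`. Together they cost at most `4 * δ * maxCut
  -- G`.
  have hm' : (δ : ℝ) * m ≤ δ * (2 * maxCut G) := by gcongr
  have hε' : 4 * (δ : ℝ) * maxCut G ≤ ε * maxCut G := by gcongr
  have hq : ((cutEstimate C δ (Fintype.card V) N (allTokens G ident ω C) : ℚ) : ℝ) =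
      2 ^ j * (separatedCount E (bestCut N E) : ℝ) - δ * m := by
    rw [cutEstimate, edgeCount_allTokens G ω C hid, ← hj]
    push_cast
    rfl
  refine ⟨?_, cutEstimate C δ (Fintype.card V) N (allTokens G ident ω C), fun _ => rfl, ?_, ?_⟩
  · simp only [decide_eq_true_eq]
    linarith
  · rw [hq]; linarith
  · rw [hq]; linarith

theorem card_filter_sampledEdges {F : Finset (V × V)} (hF : F ⊆ orientedEdges G ident) :
    (#{e ∈ sampledEdges G ident ω C | e ∈ F} : ℝ) =
      ∑ e ∈ F, headsIndicator (edgeCoins ident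
        (samplingExponent C (Fintype.card V) #(orientedEdges G ident)) e) ω := by
  simp only [headsIndicator]
  rw [sum_boole]
  congr 2
  ext e
  simp only [sampledEdges, mem_filter]
  have := @hF e
  tauto

/-- The number of sampled edges in `F` differs from its expectation by at most `δ` times the
expected number of all sampled edges. -/
def Concentrated (ident : V → ℕ) (F : Finset (V × V)) : Prop :=
  |(#{e ∈ sampledEdges G ident ω C | e ∈ F} : ℝ) - (1 / 2) ^ samplingExponent C (Fintype.card V)
      #(orientedEdges G ident) * #F| ≤
    δ * ((1 / 2) ^ samplingExponent C (Fintype.card V) #(orientedEdges G ident) *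
      #(orientedEdges G ident))

/-- This upper bound on the expected sample size keeps the flooding short. The lower bound in
`le_half_pow_mul` drives the Chernoff estimate and is lost only when every edge is kept. -/
theorem half_pow_mul_lt (hC : 0 < C) {n : ℕ} (hn : 0 < n) (m : ℕ) :
    (1 / 2 : ℝ) ^ samplingExponent C n m * m < 2 * (C * n) := by
  have hCn : 0 < C * n := Nat.mul_pos hC hn
  have h := Nat.lt_pow_succ_log_self (b := 2) (by norm_num) (m / (C * n))
  rw [Nat.div_lt_iff_lt_mul hCn] at h
  have h' : (m : ℝ) < 2 ^ (samplingExponent C n m + 1) * (C * n) := by exact_mod_cast h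
  rw [one_div, inv_pow, inv_mul_lt_iff₀ (by positivity)]
  rw [pow_succ] at h'
  linarith

theorem le_half_pow_mul {n m : ℕ} (hj : samplingExponent C n m ≠ 0) :
    (C * n : ℝ) ≤ (1 / 2) ^ samplingExponent C n m * m := by
  have h0 : m / (C * n) ≠ 0 := by
    intro h
    rw [samplingExponent, h] at hj
    simp at hj
  have h := Nat.pow_log_le_self 2 h0
  have h2 : 2 ^ samplingExponent C n m * (C * n) ≤ m :=
    (Nat.mul_le_mul_right _ h).trans (Nat.div_mul_le_self _ _)
  have h' : (2 ^ samplingExponent C n m * (C * n) : ℝ) ≤ m := by exact_mod_cast h2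
  rw [one_div, inv_pow, le_inv_mul_iff₀ (by positivity)]
  exact h'

theorem card_sampledEdges_le (hC : 0 < C) (hn : 0 < Fintype.card V) (hδ : δ ≤ 1)
    (h : Concentrated G ω C δ ident (orientedEdges G ident)) :
    #(sampledEdges G ident ω C) ≤ 4 * C * Fintype.card V := by
  have hs : {e ∈ sampledEdges G ident ω C | e ∈ orientedEdges G ident} = sampledEdges G ident ω C :=
    filter_true_of_mem fun e he => (mem_filter.1 he).1
  have h1 := (abs_le.1 h).2
  rw [hs] at h1
  have h2 := half_pow_mul_lt C hC hn #(orientedEdges G ident)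
  set p : ℝ := (1 / 2) ^ samplingExponent C (Fintype.card V) #(orientedEdges G ident)
  have h3 : (0 : ℝ) ≤ p * #(orientedEdges G ident) := by positivity
  have hδ' : (δ : ℝ) ≤ 1 := by exact_mod_cast hδ
  have h4 := mul_le_mul_of_nonneg_right hδ' h3
  have : (#(sampledEdges G ident ω C) : ℝ) ≤ 4 * C * Fintype.card V := by linarith
  exact_mod_cast this

theorem prob_not_concentrated_le (hid : Function.Injective ident) (hδ : 0 ≤ δ) (hδ1 : δ ≤ 1)
    {F : Finset (V × V)} (hF : F ⊆ orientedEdges G ident) :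
    (coinLaw V).real {ω | ¬ Concentrated G ω C δ ident F} ≤
      2 * Real.exp (-(C * Fintype.card V * ((δ : ℝ) ^ 2 / 4))) := by
  have hδ' : (0 : ℝ) ≤ δ := by exact_mod_cast hδ
  have hδ1' : (δ : ℝ) ≤ 1 := by exact_mod_cast hδ1
  simp only [Concentrated, card_filter_sampledEdges G _ C hF, not_le]
  by_cases hj : samplingExponent C (Fintype.card V) #(orientedEdges G ident) = 0
  -- For `j = 0` every edge is sampled and there is no deviation at all.
  · have hempty : {ω : V × ℕ → Bool | δ * ((1 / 2 : ℝ) ^ 0 * #(orientedEdges G ident)) <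
        |∑ e ∈ F, headsIndicator (edgeCoins ident 0 e) ω - (1 / 2) ^ 0 * #F|} = ∅ := by
      refine Set.eq_empty_of_forall_notMem fun ω hω => ?_
      have h1 : ∀ e, headsIndicator (edgeCoins ident 0 e) ω = 1 := fun e => by
        simp [headsIndicator, edgeCoins]
      simp only [Set.mem_ofPred_eq, h1, sum_const, nsmul_eq_mul, mul_one, pow_zero, one_mul,
        sub_self, abs_zero] at hω
      exact hω.not_ge (by positivity)
    rw [hj, hempty, measureReal_empty]
    positivity
  · refine (chernoff_headsIndicator (pairwiseDisjoint_edgeCoins hid _ _)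
      (fun e _ => card_edgeCoins ident _ e) (card_le_card hF) hδ' hδ1').trans ?_
    have := le_half_pow_mul C hj
    gcongr

theorem prob_failure_le {ε : ℝ} (hδε : 4 * (δ : ℝ) ≤ ε) (hδ : 0 ≤ δ) (hδ1 : δ ≤ 1) (hC : 0 < C)
    (hG : G.Connected) (hid : Function.Injective ident)
    (hlt : ∀ v, ident v < Fintype.card V ^ κ) :
    (coinLaw V).real {ω | ¬ IsMaxCutApprox G ε ((maxCutAlgorithm C κ δ).result G ident ω)} ≤
      (2 ^ Fintype.card V + 1) * (2 * Real.exp (-(C * Fintype.card V * ((δ : ℝ) ^ 2 / 4)))) := by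
  have hn : 0 < Fintype.card V := Fintype.card_pos_iff.2 hG.nonempty
  -- The full edge set is included to bound the sample size, so that the flooding ends in time; the
  -- cuts are there for the quality of the result.
  set 𝓕 : Finset (Finset (V × V)) :=
    insert (orientedEdges G ident) (univ.image (cutEdges G ident))
  have hsub : ∀ F ∈ 𝓕, F ⊆ orientedEdges G ident := by
    intro F hF
    rcases mem_insert.1 hF with rfl | hF
    · exact Subset.rfl
    · obtain ⟨S, -, rfl⟩ := mem_image.1 hF
      exact filter_subset _ _
  have hcard : #𝓕 ≤ 2 ^ Fintype.card V + 1 := by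
    refine (card_insert_le _ _).trans (Nat.add_le_add_right (card_image_le.trans_eq ?_) 1)
    rw [card_univ, Fintype.card_finset]
  calc (coinLaw V).real {ω | ¬ IsMaxCutApprox G ε ((maxCutAlgorithm C κ δ).result G ident ω)}
      ≤ (coinLaw V).real (⋃ F ∈ 𝓕, {ω | ¬ Concentrated G ω C δ ident F}) := by
        refine measureReal_mono (fun ω hω => ?_) (measure_ne_top _ _)
        by_contra hgood
        simp only [Set.mem_iUnion, Set.mem_ofPred_eq, not_exists, not_not] at hgood
        refine hω ?_
        have hres := result_eq G ω C κ δ hG hid hlt (card_sampledEdges_le G ω C δ hC hn hδ1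
          (hgood _ (mem_insert_self _ _)))
        rw [funext hres]
        refine isMaxCutApprox_of_concentrated G ω C κ δ hδε hδ hid hlt rfl fun S => ?_
        have h := hgood _ (mem_insert_of_mem (mem_image_of_mem _ (mem_univ S)))
        have heq : {e ∈ sampledEdges G ident ω C | e ∈ cutEdges G ident S} =
            {e ∈ sampledEdges G ident ω C | ¬ (e.1 ∈ S ↔ e.2 ∈ S)} :=
          filter_congr fun e he => by
            have := (mem_filter.1 he).1
            simp [cutEdges, this]
        rw [Concentrated, heq] at h
        exact h
    _ ≤ ∑ F ∈ 𝓕, (coinLaw V).real {ω | ¬ Concentrated G ω C δ ident F} :=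
        measureReal_biUnion_finset_le _ _
    _ ≤ ∑ _F ∈ 𝓕, 2 * Real.exp (-(C * Fintype.card V * ((δ : ℝ) ^ 2 / 4))) :=
        sum_le_sum fun F hF => prob_not_concentrated_le G C δ hid hδ hδ1 (hsub F hF)
    _ ≤ _ := by
        rw [sum_const, nsmul_eq_mul]
        have : (#𝓕 : ℝ) ≤ 2 ^ Fintype.card V + 1 := by exact_mod_cast hcard
        gcongr

end Correctness

/-- The prefactor `(2 ^ n + 1) * 2` is at most `exp (3 * n)`, and `n ^ c ≤ exp (c * n)`. -/
theorem failure_bound {n c : ℕ} (hn : 0 < n) {a : ℝ} (ha : (c : ℝ) + 3 ≤ a) :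
    (2 ^ n + 1) * (2 * Real.exp (-(a * n))) ≤ 1 / (n : ℝ) ^ c := by
  have hn1 : (1 : ℝ) ≤ n := by exact_mod_cast hn
  have h2 : (2 : ℝ) ≤ Real.exp 1 := by linarith [Real.add_one_le_exp (1 : ℝ)]
  have h2n : (2 : ℝ) ^ n ≤ Real.exp n := by
    rw [← Real.exp_one_pow]
    exact pow_le_pow_left₀ (by norm_num) h2 n
  have h1n : (1 : ℝ) ≤ Real.exp n := Real.one_le_exp (by linarith)
  have hen : Real.exp 1 ≤ Real.exp n := Real.exp_le_exp.2 hn1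
  have h4 : ((2 : ℝ) ^ n + 1) * 2 ≤ Real.exp n * Real.exp n * Real.exp n := by
    have e1 : (2 : ℝ) ^ n + 1 ≤ Real.exp n * 2 := by linarith
    have e2 : Real.exp n * 2 ≤ Real.exp n * Real.exp n :=
      mul_le_mul_of_nonneg_left (h2.trans hen) (Real.exp_pos _).le
    exact mul_le_mul (e1.trans e2) (h2.trans hen) (by norm_num) (by positivity)
  have hnc : (n : ℝ) ^ c ≤ Real.exp (c * n) := by
    rw [Real.exp_nat_mul]
    exact pow_le_pow_left₀ (by linarith) (by linarith [Real.add_one_le_exp (n : ℝ)]) c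
  rw [le_div_iff₀ (by positivity)]
  calc (2 ^ n + 1) * (2 * Real.exp (-(a * n))) * (n : ℝ) ^ c
      = ((2 ^ n + 1) * 2) * (Real.exp (-(a * n)) * (n : ℝ) ^ c) := by ring
    _ ≤ (Real.exp n * Real.exp n * Real.exp n) * (Real.exp (-(a * n)) * Real.exp (c * n)) := by
        gcongr
    _ = Real.exp ((c + 3 - a) * n) := by
        simp only [← Real.exp_add]
        congr 1
        ring
    _ ≤ 1 := by
        rw [← Real.exp_zero, Real.exp_le_exp]
        exact mul_nonpos_of_nonpos_of_nonneg (by linarith) (by linarith)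

theorem mainTheorem6 (ε : ℝ) (hε : 0 < ε) :
    ∃ k : ℕ, ∀ κ c : ℕ, ∃ (β : ℕ) (A : CongestAlgorithm β (Bool × ℚ)),
      (fun n : ℕ => (A.rounds n : ℝ)) =O[Filter.atTop] (fun n : ℕ => (n : ℝ) * Real.log n ^ k) ∧
      ∀ (V : Type*) [Fintype V] [DecidableEq V] (G : SimpleGraph V) [DecidableRel G.Adj]
        (ident : V → ℕ),
        G.Connected → Function.Injective ident → (∀ v, ident v < Fintype.card V ^ κ) →
          (coinLaw V).real {ω | ¬ IsMaxCutApprox G ε (A.result G ident ω)}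
            ≤ 1 / (Fintype.card V : ℝ) ^ c := by
  -- The number of rounds is linear in `n`, so no logarithmic factor is needed.
  refine ⟨0, fun κ c => ?_⟩
  obtain ⟨δ, hδ, hδε⟩ := exists_rat_btwn (lt_min (by linarith : (0 : ℝ) < ε / 4) one_pos)
  rw [lt_min_iff] at hδε
  -- This makes the Chernoff exponent per vertex, `C * δ² / 4`, at least the `c + 3` that
  -- `failure_bound` asks for.
  obtain ⟨C, hC⟩ := exists_nat_ge ((c + 3 : ℝ) / ((δ : ℝ) ^ 2 / 4))
  have hδ2 : (0 : ℝ) < (δ : ℝ) ^ 2 / 4 := by positivity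
  have hC0 : 0 < C := by
    have : (0 : ℝ) < C := lt_of_lt_of_le (by positivity) hC
    exact_mod_cast this
  rw [div_le_iff₀ hδ2] at hC
  refine ⟨2 * κ + 3, maxCutAlgorithm C κ δ, ?_, ?_⟩
  · refine IsBigO.of_bound (8 * C + 5) (Filter.eventually_atTop.2 ⟨1, fun n hn => ?_⟩)
    have hn1 : (1 : ℝ) ≤ n := by exact_mod_cast hn
    simp only [maxCutAlgorithm, pow_zero, mul_one, Real.norm_natCast]
    push_cast
    linarith
  · intro V _ _ G _ ident hG hid hlt
    refine (prob_failure_le G C κ δ (by linarith [hδε.1]) (by exact_mod_cast hδ.le)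
      (by exact_mod_cast hδε.2.le) hC0 hG hid hlt).trans ?_
    rw [mul_right_comm]
    exact failure_bound (Fintype.card_pos_iff.2 hG.nonempty) hC
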